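/- **Setting.** A seller offers one item in each of $m\ge 1$ consecutive stages to a single buyer. The buyer's value for the item of stage $k$ is a random variable $X_k$ with values in a bounded measurable set $V_k\subseteq[0,\infty)$ (for instance an interval or a finite set), which she learns at the beginning of stage $k$. The stages may be arbitrarily correlated: for every history $v_{<k}=(v_1,\dots,v_{k-1})\in V_1\times\dots\times V_{k-1}$ a conditional distribution $X_k\mid v_{<k}$ on $V_k$ is given (depending measurably on $v_{<k}$), and these determine the joint law of $(X_1,\dots,X_m)$. A direct mechanism consists of measurable allocation probabilities $x_k(v_{\le k})\in[0,1]$ and payments $p_k(v_{\le k})\in\mathbb R$, $k=1,\dots,m$, depending on the values reported in stages $1,\dots,k$; let $u_k(v_{\le k})=v_kx_k(v_{\le k})-p_k(v_{\le k})$. The mechanism is *ex-post individually rational* if $u_k(v_{\le k})\ge 0$ for all $k$ and all $v_{\le k}\in V_1\times\dots\times V_k$. It is *periodic incentive compatible* if for all $k$, all $v_{\le k}\in V_1\times\dots\times V_k$ and all $\hat v_k\in V_k$ $$u_k(v_{\le k})+\mathbb E\Big[\sum_{i>k}u_i(v_{\le k},X_{k+1},\dots,X_i)\,\Big|\,v_{\le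 k}\Big]\;\ge\; v_kx_k(v_{<k},\hat v_k)-p_k(v_{<k},\hat v_k)+\mathbb E\Big[\sum_{i>k}u_i(v_{<k},\hat v_k,X_{k+1},\dots,X_i)\,\Big|\,v_{\le k}\Big],$$ where on both sides $X_{k+1},\dots,X_m$ are drawn conditionally on the true values $v_{\le k}$ and the expectations are required to exist. Let $\mathrm{OPT}$ be the supremum of the expected revenue $\mathbb E\big[\sum_{k=1}^m p_k(X_1,\dots,X_k)\big]$ over all ex-post individually rational, periodic incentive compatible mechanisms (for which this expectation exists). For a distribution $D$ on $V_j$ let $\mathrm{Myerson}(D)$ be the optimal expected revenue of a one-shot, individually rational, incentive compatible mechanism selling one item to one buyer with value drawn from $D$. **Lemma.** Suppose that for every stage $k$ and any two histories $v_{<k},v'_{<k}\in V_1\times\dots\times V_{k-1}$ with $v_t\ge v'_t$ for all $t<k$, the conditional distribution $X_k\mid v_{<k}$ (first-order) stochastically dominates the conditional distribution $X_k\mid v'_{<k}$. Then $$\mathrm{OPT}\;\le\;\min_{j=1,\dots,m}\Big\{\mathbb E\big[\mathrm{Myerson}(X_j\mid X_{<j})\big]+\sum_{k\ne j}\mathbb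 E[X_k]\Big\}.$$ -/

import Mathlib

open MeasureTheory ProbabilityTheory
open scoped ENNReal

noncomputable section

namespace DynamicAuction

/-- The valuation model of a single buyer over `m` stages. `V k` is the set of possible values of
stage `k` (an interval or a discrete set, for instance), and `law k h` is the conditional
distribution of the value `X_k` of stage `k` given the history `h` of the values of the earlier
stages. The stages may be correlated in an arbitrary way. Histories are allowed to be any element
of the product of the sets `V t`; what `law k` does on other arguments plays no role. -/
structure Environment (m : ℕ) where
  V : Fin m → Set ℝ
  measurableSet_V : ∀ k, MeasurableSet (V k)
  nonneg : ∀ k, ∀ a ∈ V k, 0 ≤ a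
  bddAbove : ∀ k, BddAbove (V k)
  law : (k : Fin m) → Kernel (Set.Iio k → ℝ) ℝ
  isMarkov : ∀ k, IsMarkovKernel (law k)
  law_compl : ∀ (k : Fin m) (h : Set.Iio k → ℝ), (∀ t : Set.Iio k, h t ∈ V t) →
    law k h (V k)ᶜ = 0

namespace Environment

variable {m : ℕ}

/-- The profiles `(v_1, …, v_m)` of possible values. -/
def profiles (E : Environment m) : Set (Fin m → ℝ) := Set.univ.pi E.V

/-- Draw the value of stage `k` from its conditional distribution given the coordinates of `v`
before `k`, and put it in place of the coordinate `k` of `v`. -/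
def draw (E : Environment m) (k : Fin m) : Kernel (Fin m → ℝ) (Fin m → ℝ) :=
  (Kernel.id ×ₖ (E.law k).comap (fun v (t : Set.Iio k) => v t) (by fun_prop)).map
    (fun q => Function.update q.1 k q.2)

/-- Draw the values of the stages `k, k + 1, …, m - 1` (counted from `0`) one after the other.
Thus `E.drawFrom k v` is the conditional distribution of the whole profile, given that its
coordinates before `k` are those of `v`. -/
def drawFrom (E : Environment m) (k : ℕ) : Kernel (Fin m → ℝ) (Fin m → ℝ) :=
  if h : k < m then E.drawFrom (k + 1) ∘ₖ E.draw ⟨k, h⟩ else Kernel.id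
termination_by m - k

/-- The joint distribution of `(X_1, …, X_m)`; since every coordinate is drawn, the starting
point `0` plays no role. -/
def prior (E : Environment m) : Measure (Fin m → ℝ) := E.drawFrom 0 0

/-- The conditional distribution `X_k | X_{<k}`, where the history consists of the coordinates of
`v` before `k`. -/
def stageLaw (E : Environment m) (k : Fin m) (v : Fin m → ℝ) : Measure ℝ :=
  E.law k (fun t => v t)

end Environment

/-- `μ` (first-order) stochastically dominates `ν`: the distribution function of `μ` is at most
that of `ν`. -/
def StochasticallyDominates (μ ν : Measure ℝ) : Prop :=
  ∀ a : ℝ, μ (Set.Iic a) ≤ ν (Set.Iic a)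

/-- For every stage `k` and any two histories `h' ≤ h`, the conditional distribution of the value
of stage `k` given `h` stochastically dominates the one given `h'`. -/
def Environment.StochasticallyMonotone {m : ℕ} (E : Environment m) : Prop :=
  ∀ (k : Fin m) (h h' : Set.Iio k → ℝ), (∀ t : Set.Iio k, h t ∈ E.V t) →
    (∀ t : Set.Iio k, h' t ∈ E.V t) → (∀ t : Set.Iio k, h' t ≤ h t) →
      StochasticallyDominates (E.law k h) (E.law k h')

/-- A direct mechanism for one buyer: the allocation probability and the payment of stage `k` are
functions of the reports of the stages up to and including `k`. -/
structure Mechanism (m : ℕ) where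
  x : (k : Fin m) → (Set.Iic k → ℝ) → ℝ
  p : (k : Fin m) → (Set.Iic k → ℝ) → ℝ
  measurable_x : ∀ k, Measurable (x k)
  measurable_p : ∀ k, Measurable (p k)

namespace Mechanism

variable {m : ℕ}

def alloc (M : Mechanism m) (k : Fin m) (r : Fin m → ℝ) : ℝ := M.x k (fun t => r t)

def pay (M : Mechanism m) (k : Fin m) (r : Fin m → ℝ) : ℝ := M.p k (fun t => r t)

/-- The utility of stage `k` of a buyer with values `v` who reports `r`. -/
def stageUtility (M : Mechanism m) (k : Fin m) (v r : Fin m → ℝ) : ℝ :=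
  v k * M.alloc k r - M.pay k r

/-- The utility from stage `k` on of a buyer with values `v` who reports `r`. -/
def utilityFrom (M : Mechanism m) (k : Fin m) (v r : Fin m → ℝ) : ℝ :=
  ∑ j ∈ Finset.Ici k, M.stageUtility j v r

def Feasible (M : Mechanism m) (E : Environment m) : Prop :=
  ∀ k, ∀ v ∈ E.profiles, M.alloc k v ∈ Set.Icc (0 : ℝ) 1

/-- Ex-post individual rationality: no stage utility is ever negative. -/
def ExPostIR (M : Mechanism m) (E : Environment m) : Prop :=
  ∀ k, ∀ v ∈ E.profiles, 0 ≤ M.stageUtility k v v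

/-- Periodic incentive compatibility. At stage `k`, with (truthfully reported) history and current
value given by the coordinates of `v` up to `k`, reporting the truth is at least as good as
reporting `a` now, when all later reports are truthful. The later values are drawn conditionally on
the true values. The expected utilities that are compared have to exist. -/
def PeriodicIC (M : Mechanism m) (E : Environment m) : Prop :=
  ∀ k : Fin m, ∀ v ∈ E.profiles, ∀ a ∈ E.V k,
    Integrable (fun w => M.utilityFrom k w w) (E.drawFrom (k + 1) v) ∧
    Integrable (fun w => M.utilityFrom k w (Function.update w k a)) (E.drawFrom (k + 1) v) ∧
    ∫ w, M.utilityFrom k w (Function.update w k a) ∂(E.drawFrom (k + 1) v) ≤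
      ∫ w, M.utilityFrom k w w ∂(E.drawFrom (k + 1) v)

/-- The total payment under truthful reports. -/
def totalPay (M : Mechanism m) (v : Fin m → ℝ) : ℝ := ∑ k, M.pay k v

def revenue (M : Mechanism m) (E : Environment m) : ℝ := ∫ v, M.totalPay v ∂E.prior

/-- The mechanisms over which the seller optimizes: feasible, ex-post IR, periodic IC, and with an
expected revenue that exists. -/
def Admissible (M : Mechanism m) (E : Environment m) : Prop :=
  M.Feasible E ∧ M.ExPostIR E ∧ M.PeriodicIC E ∧ Integrable M.totalPay E.prior

end Mechanism

/-- The optimal revenue (a supremum in `[0, ∞]`). The mechanism that never allocates and never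
charges is admissible, so cutting negative revenues off at `0` does not change the supremum. -/
def opt {m : ℕ} (E : Environment m) : ℝ≥0∞ :=
  ⨆ (M : Mechanism m) (_ : M.Admissible E), ENNReal.ofReal (M.revenue E)

/-- A one-shot direct mechanism `(x, p)` for one buyer with value in `V`, drawn from `μ`, that is
feasible, individually rational and incentive compatible. -/
structure StaticAdmissible (V : Set ℝ) (μ : Measure ℝ) (x p : ℝ → ℝ) : Prop where
  measurable_x : Measurable x
  measurable_p : Measurable p
  feasible : ∀ a ∈ V, x a ∈ Set.Icc (0 : ℝ) 1
  ir : ∀ a ∈ V, 0 ≤ a * x a - p a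
  ic : ∀ a ∈ V, ∀ b ∈ V, a * x b - p b ≤ a * x a - p a
  integrable : Integrable p μ

/-- The revenue of Myerson's auction, that is, the optimal revenue of a one-shot mechanism for one
buyer with value in `V`, drawn from `μ`. Again negative revenues do not matter. -/
def myerson (V : Set ℝ) (μ : Measure ℝ) : ℝ≥0∞ :=
  ⨆ (x : ℝ → ℝ) (p : ℝ → ℝ) (_ : StaticAdmissible V μ x p), ENNReal.ofReal (∫ a, p a ∂μ)

/-- `𝔼[Myerson(X_j | X_{<j})]`. -/
def expectedMyerson {m : ℕ} (E : Environment m) (j : Fin m) : ℝ≥0∞ :=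
  ∫⁻ v, myerson (E.V j) (E.stageLaw j v) ∂E.prior

/-- `𝔼[X_k]`, as an element of `[0, ∞]`; the values are nonnegative and bounded. -/
def expectedValue {m : ℕ} (E : Environment m) (k : Fin m) : ℝ≥0∞ :=
  ENNReal.ofReal (∫ v, v k ∂E.prior)

end DynamicAuction

end

/-! Payments equal welfare minus utility. Utility earned before stage `j` is nonnegative and the
welfare of a stage `k ≠ j` is at most `X_k`, so it suffices that the expected welfare of stage `j`
minus the utility from stage `j` on is at most Myerson's revenue, conditionally on the history
(`lintegral_stage_welfare_le`).

Fix the history and regard stage `j` as a one-shot mechanism whose utility `U` is the expected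
utility from `j` on. A buyer of value `b` who reports `a ≤ b` gains `(b - a) x(a)` over a true `a`
at stage `j`. Her later values follow laws conditioned on a larger history, which cannot hurt her:
this is `dominanceFrom`, a backward induction in which downward incentive compatibility makes
utilities monotone and monotone utilities profit from dominance. Hence `U(a) + (b - a) x(a) ≤ U(b)`
for `a ≤ b`.

Upward deviations are not controlled, so `x` need not be monotone. Its running maximum `X` is, and
the downward inequalities already give `U(z) ≥ ∫₀ᶻ X` (`integral_runningMax_le`). The envelope
payment for `X` makes a genuine static mechanism, whose payment is pointwise at least `a x(a) -
U(a)`. -/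

noncomputable section

namespace DynamicAuction

/-! ### One-shot screening with downward incentive constraints only -/

/-- The running maximum of `x` over the points of `V`. -/
def runningMax (V : Set ℝ) (x : ℝ → ℝ) (t : ℝ) : ℝ :=
  sSup (insert 0 (x '' (V ∩ Set.Iic t)))

section RunningMax

variable {V : Set ℝ} {x : ℝ → ℝ}

lemma bddAbove_runningMax (hx : ∀ a ∈ V, x a ∈ Set.Icc (0 : ℝ) 1) (t : ℝ) :
    BddAbove (insert 0 (x '' (V ∩ Set.Iic t))) := by
  refine ⟨1, ?_⟩
  rintro _ (rfl | ⟨a, ⟨ha, -⟩, rfl⟩)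
  · exact zero_le_one
  · exact (hx a ha).2

lemma runningMax_nonneg (hx : ∀ a ∈ V, x a ∈ Set.Icc (0 : ℝ) 1) (t : ℝ) :
    0 ≤ runningMax V x t :=
  le_csSup (bddAbove_runningMax hx t) (Set.mem_insert _ _)

lemma runningMax_le {t c : ℝ} (hc : 0 ≤ c) (h : ∀ a ∈ V, a ≤ t → x a ≤ c) :
    runningMax V x t ≤ c := by
  refine csSup_le (Set.insert_nonempty _ _) ?_
  rintro _ (rfl | ⟨a, ⟨ha, hat⟩, rfl⟩)
  · exact hc
  · exact h a ha hat

lemma le_runningMax (hx : ∀ a ∈ V, x a ∈ Set.Icc (0 : ℝ) 1) {a t : ℝ} (ha : a ∈ V) (hat : a ≤ t) :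
    x a ≤ runningMax V x t :=
  le_csSup (bddAbove_runningMax hx t) (Set.mem_insert_of_mem _ ⟨a, ⟨ha, hat⟩, rfl⟩)

lemma runningMax_monotone (hx : ∀ a ∈ V, x a ∈ Set.Icc (0 : ℝ) 1) : Monotone (runningMax V x) :=
  fun _ _ hst => runningMax_le (runningMax_nonneg hx _)
    fun _ ha has => le_runningMax hx ha (has.trans hst)

lemma runningMax_le_one (hx : ∀ a ∈ V, x a ∈ Set.Icc (0 : ℝ) 1) (t : ℝ) :
    runningMax V x t ≤ 1 :=
  runningMax_le zero_le_one fun a ha _ => (hx a ha).2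

end RunningMax

/-- Subgradient inequality of the convex function `b ↦ ∫₀ᵇ f`. No order between `a` and `b` is
needed, so it handles upward and downward deviations alike. -/
lemma Monotone.mul_sub_le_integral {f : ℝ → ℝ} (hf : Monotone f) (a b : ℝ) :
    (b - a) * f a ≤ ∫ t in a..b, f t := by
  rcases le_total a b with hab | hba
  · have := intervalIntegral.integral_mono_on hab (intervalIntegrable_const (c := f a))
      (hf.intervalIntegrable (μ := volume)) (fun t ht => hf ht.1)
    simpa using this
  · have := intervalIntegral.integral_mono_on hba (hf.intervalIntegrable (μ := volume))
      (intervalIntegrable_const (c := f a)) (fun t ht => hf ht.2)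
    rw [intervalIntegral.integral_symm]
    simp only [intervalIntegral.integral_const, smul_eq_mul] at this
    linarith

/-- If only downward deviations are unprofitable, the utility is at least the integral of the
running maximum of the allocation, up to a discretization error. -/
lemma integral_min_runningMax_le {V : Set ℝ} {x U : ℝ → ℝ} (hV : ∀ a ∈ V, 0 ≤ a)
    (hx : ∀ a ∈ V, x a ∈ Set.Icc (0 : ℝ) 1) (hU : ∀ a ∈ V, 0 ≤ U a)
    (hic : ∀ a ∈ V, ∀ b ∈ V, a ≤ b → U a + (b - a) * x a ≤ U b)
    {ε δ : ℝ} (hε : 0 < ε) (hδ : 0 < δ) (n : ℕ) :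
    ∀ z ∈ V, ∫ t in (0 : ℝ)..z, min (runningMax V x t) (n * ε) ≤ U z + ε * z + n * ε * δ := by
  have hmono : ∀ c : ℝ, Monotone fun t => min (runningMax V x t) c := fun c =>
    (runningMax_monotone hx).min monotone_const
  have hint : ∀ c a b : ℝ,
      IntervalIntegrable (fun t => min (runningMax V x t) c) volume a b := fun c a b =>
    (hmono c).intervalIntegrable
  induction n with
  | zero =>
    intro z hz
    have h0 : ∀ t, min (runningMax V x t) 0 = 0 := fun t => min_eq_right (runningMax_nonneg hx t)
    have := hV z hz
    have := hU z hz
    simp only [Nat.cast_zero, zero_mul, h0, intervalIntegral.integral_zero]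
    positivity
  | succ n ih =>
    intro z hz
    have hz0 := hV z hz
    have hn : (0 : ℝ) ≤ n * ε := by positivity
    have hn1 : ((n + 1 : ℕ) : ℝ) * ε = n * ε + ε := by push_cast; ring
    have hεδ : 0 ≤ ε * δ := by positivity
    rw [hn1]
    -- Left of the infimum `s` of these points, raising the cap from `n * ε` to `n * ε + ε` changes
    -- nothing. The infimum may not be attained, so a point `y` within `δ` of it is used; the gap
    -- `[s, y]` costs at most `ε * δ`.
    by_cases hT : ∃ y ∈ V, y ≤ z ∧ n * ε < x y
    · obtain ⟨y, ⟨hyV, hyz, hxy⟩, hys⟩ := Real.lt_sInf_add_pos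
        (s := {y | y ∈ V ∧ y ≤ z ∧ n * ε < x y}) hT hδ
      have hbdd : BddBelow {y | y ∈ V ∧ y ≤ z ∧ n * ε < x y} := ⟨0, fun y hy => hV y hy.1⟩
      have hs0 : 0 ≤ sInf {y | y ∈ V ∧ y ≤ z ∧ n * ε < x y} := le_csInf hT fun y hy => hV y hy.1
      have hsy : sInf {y | y ∈ V ∧ y ≤ z ∧ n * ε < x y} ≤ y := csInf_le hbdd ⟨hyV, hyz, hxy⟩
      set s := sInf {y | y ∈ V ∧ y ≤ z ∧ n * ε < x y} with hs
      have h1 : ∫ t in (0 : ℝ)..s, min (runningMax V x t) (n * ε + ε) ≤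
          ∫ t in (0 : ℝ)..s, min (runningMax V x t) (n * ε) := by
        refine intervalIntegral.integral_mono_on_of_le_Ioo hs0 (hint _ _ _) (hint _ _ _) ?_
        intro t ht
        refine (min_le_left _ _).trans (le_min le_rfl (runningMax_le hn fun a ha hat => ?_))
        by_contra! hlt
        exact absurd (csInf_le hbdd ⟨ha, (hat.trans ht.2.le).trans (hsy.trans hyz), hlt⟩)
          (not_le.2 (hat.trans_lt ht.2))
      have h2 : ∫ t in s..y, min (runningMax V x t) (n * ε + ε) ≤
          (∫ t in s..y, min (runningMax V x t) (n * ε)) + ε * (y - s) := by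
        have := intervalIntegral.integral_mono_on hsy (hint (n * ε + ε) s y)
          ((hint (n * ε) s y).add (intervalIntegrable_const (c := ε))) fun t _ => by
            rcases le_total (runningMax V x t) (n * ε) with h | h
            · rw [min_eq_left h]; exact (min_le_left _ _).trans (by linarith)
            · rw [min_eq_right h]; exact min_le_right _ _
        rw [intervalIntegral.integral_add (hint _ _ _) intervalIntegrable_const] at this
        simp only [intervalIntegral.integral_const, smul_eq_mul] at this
        linarith
      have h3 : ∫ t in y..z, min (runningMax V x t) (n * ε + ε) ≤ (n * ε + ε) * (z - y) := by
        have := intervalIntegral.integral_mono_on hyz (hint (n * ε + ε) y z)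
          (intervalIntegrable_const (c := n * ε + ε)) fun t _ => min_le_right _ _
        simp only [intervalIntegral.integral_const, smul_eq_mul] at this
        linarith
      -- The induction hypothesis is needed at `y`, not at `z`: on `[y, z]` the utility grows with
      -- slope at least `x y > n * ε`, while the integrand is at most `n * ε + ε`, leaving an error
      -- `ε * (z - y)`.
      have h4 := ih y hyV
      have h5 := hic y hyV z hz hyz
      have h6 : (z - y) * (n * ε) ≤ (z - y) * x y :=
        mul_le_mul_of_nonneg_left hxy.le (sub_nonneg.2 hyz)
      have h7 : ε * (y - s) ≤ ε * δ := mul_le_mul_of_nonneg_left (by linarith) hε.le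
      rw [← intervalIntegral.integral_add_adjacent_intervals (hint _ 0 s) (hint _ s y)] at h4
      rw [← intervalIntegral.integral_add_adjacent_intervals (hint _ 0 y) (hint _ y z),
        ← intervalIntegral.integral_add_adjacent_intervals (hint _ 0 s) (hint _ s y)]
      linarith
    · push Not at hT
      have := ih z hz
      have h1 : ∫ t in (0 : ℝ)..z, min (runningMax V x t) (n * ε + ε) ≤
          ∫ t in (0 : ℝ)..z, min (runningMax V x t) (n * ε) := by
        refine intervalIntegral.integral_mono_on hz0 (hint _ _ _) (hint _ _ _) fun t ht => ?_
        exact (min_le_left _ _).trans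
          (le_min le_rfl (runningMax_le hn fun a ha hat => hT a ha (hat.trans ht.2)))
      linarith

lemma integral_runningMax_le {V : Set ℝ} {x U : ℝ → ℝ} (hV : ∀ a ∈ V, 0 ≤ a)
    (hx : ∀ a ∈ V, x a ∈ Set.Icc (0 : ℝ) 1) (hU : ∀ a ∈ V, 0 ≤ U a)
    (hic : ∀ a ∈ V, ∀ b ∈ V, a ≤ b → U a + (b - a) * x a ≤ U b) {z : ℝ} (hz : z ∈ V) :
    ∫ t in (0 : ℝ)..z, runningMax V x t ≤ U z := by
  have hz0 := hV z hz
  refine le_of_forall_pos_le_add fun η hη => ?_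
  -- With `ε = δ = 1 / N` and `N` levels the cap is `1`, which truncates nothing, and the total
  -- error is `(z + 1) / N`.
  obtain ⟨N, hN⟩ := exists_nat_gt ((z + 1) / η)
  have hN0 : (0 : ℝ) < N := lt_of_le_of_lt (by positivity) hN
  have := integral_min_runningMax_le hV hx hU hic (ε := 1 / N) (δ := 1 / N)
    (by positivity) (by positivity) N z hz
  have h1 : (N : ℝ) * (1 / N) = 1 := by field_simp
  simp only [h1, min_eq_left (runningMax_le_one hx _)] at this
  rw [div_lt_iff₀ hη] at hN
  have h2 : 1 / (N : ℝ) * z + 1 * (1 / N) ≤ η := by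
    rw [show 1 / (N : ℝ) * z + 1 * (1 / N) = (z + 1) / N by ring, div_le_iff₀ hN0]
    linarith
  linarith

/-- Myerson's revenue bounds the revenue of a one-shot mechanism with allocation `x` and utility
`U` even if only its downward deviations are required to be unprofitable. -/
lemma lintegral_welfare_le_myerson_add {V : Set ℝ} {x U : ℝ → ℝ} {μ : Measure ℝ}
    [IsFiniteMeasure μ] (hV : ∀ a ∈ V, 0 ≤ a) (hbdd : BddAbove V) (hμ : ∀ᵐ a ∂μ, a ∈ V)
    (hx : ∀ a ∈ V, x a ∈ Set.Icc (0 : ℝ) 1) (hU : ∀ a ∈ V, 0 ≤ U a)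
    (hic : ∀ a ∈ V, ∀ b ∈ V, a ≤ b → U a + (b - a) * x a ≤ U b) :
    ∫⁻ a, ENNReal.ofReal (a * x a) ∂μ ≤ myerson V μ + ∫⁻ a, ENNReal.ofReal (U a) ∂μ := by
  obtain ⟨B, hB⟩ := hbdd
  have hmono := runningMax_monotone hx
  set X := runningMax V x with hX
  -- The envelope payment, which leaves type `a` the utility `∫₀ᵃ X`.
  set P : ℝ → ℝ := fun a => a * X a - ∫ t in (0 : ℝ)..a, X t with hP
  have hPm : Measurable P := by
    have hc : Continuous fun a => ∫ t in (0 : ℝ)..a, X t :=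
      intervalIntegral.continuous_primitive (fun a b => hmono.intervalIntegrable) 0
    exact (measurable_id.mul hmono.measurable).sub hc.measurable
  have hint0 : ∀ a ∈ V, 0 ≤ ∫ t in (0 : ℝ)..a, X t := fun a ha =>
    intervalIntegral.integral_nonneg (hV a ha) fun t _ => runningMax_nonneg hx t
  have hP0 : ∀ a ∈ V, 0 ≤ P a := fun a ha => by
    have := Monotone.mul_sub_le_integral hmono a 0
    rw [intervalIntegral.integral_symm] at this
    simp only [hP]
    linarith
  have hPB : ∀ a ∈ V, P a ≤ B := fun a ha => by
    have h1 := hint0 a ha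
    have h2 := mul_le_mul_of_nonneg_left (runningMax_le_one hx a) (hV a ha)
    have h3 := hB ha
    simp only [hP]
    linarith
  have hPi : Integrable P μ := by
    refine Integrable.of_bound hPm.aestronglyMeasurable B ?_
    filter_upwards [hμ] with a ha
    rw [Real.norm_of_nonneg (hP0 a ha)]
    exact hPB a ha
  have hadm : StaticAdmissible V μ X P :=
    { measurable_x := hmono.measurable
      measurable_p := hPm
      feasible := fun a _ => ⟨runningMax_nonneg hx a, runningMax_le_one hx a⟩
      ir := fun a ha => by
        have := hint0 a ha
        simp only [hP]
        linarith
      ic := fun a _ b _ => by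
        have h1 := Monotone.mul_sub_le_integral hmono b a
        have h2 := intervalIntegral.integral_add_adjacent_intervals
          (hmono.intervalIntegrable (μ := volume) (a := 0) (b := b))
          (hmono.intervalIntegrable (μ := volume) (a := b) (b := a))
        simp only [hP]
        linarith
      integrable := hPi }
  -- Pointwise on `V`: `a * x a ≤ a * X a = P a + ∫₀ᵃ X ≤ P a + U a`.
  calc ∫⁻ a, ENNReal.ofReal (a * x a) ∂μ
      ≤ ∫⁻ a, (ENNReal.ofReal (P a) + ENNReal.ofReal (U a)) ∂μ := by
        refine lintegral_mono_ae ?_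
        filter_upwards [hμ] with a ha
        rw [← ENNReal.ofReal_add (hP0 a ha) (hU a ha)]
        refine ENNReal.ofReal_le_ofReal ?_
        have h1 := integral_runningMax_le hV hx hU hic ha
        have h2 := mul_le_mul_of_nonneg_left (le_runningMax hx ha le_rfl) (hV a ha)
        simp only [hP]
        linarith
    _ = ∫⁻ a, ENNReal.ofReal (P a) ∂μ + ∫⁻ a, ENNReal.ofReal (U a) ∂μ :=
        lintegral_add_left hPm.ennreal_ofReal _
    _ ≤ _ := by
        gcongr
        rw [← ofReal_integral_eq_lintegral_ofReal hPi (hμ.mono hP0)]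
        exact le_iSup_of_le X (le_iSup_of_le P (le_iSup_of_le hadm le_rfl))

/-! ### First-order stochastic dominance and monotone functions -/

lemma StochasticallyDominates.measure_Iio_le {μ ν : Measure ℝ} (h : StochasticallyDominates μ ν)
    (a : ℝ) : μ (Set.Iio a) ≤ ν (Set.Iio a) := by
  obtain ⟨u, hu, hua, hlim⟩ := exists_seq_strictMono_tendsto a
  have : Set.Iio a = ⋃ n, Set.Iic (u n) := by
    ext b
    simp only [Set.mem_Iio, Set.mem_iUnion, Set.mem_Iic]
    exact ⟨fun hb => ((hlim.eventually (lt_mem_nhds hb)).exists).imp fun _ => le_of_lt,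
      fun ⟨n, hn⟩ => hn.trans_lt (hua n)⟩
  have hmono : Monotone fun n => Set.Iic (u n) := fun _ _ hnm => Set.Iic_subset_Iic.2
    (hu.monotone hnm)
  rw [this, hmono.measure_iUnion, hmono.measure_iUnion]
  exact iSup_mono fun n => h (u n)

/-- A lower set of reals is empty, everything, or a closed or open ray at its supremum. -/
lemma StochasticallyDominates.measure_isLowerSet_le {μ ν : Measure ℝ} [IsProbabilityMeasure μ]
    [IsProbabilityMeasure ν] (h : StochasticallyDominates μ ν) {s : Set ℝ} (hs : IsLowerSet s) :
    μ s ≤ ν s := by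
  by_cases hne : s.Nonempty
  · by_cases hb : BddAbove s
    · by_cases hmem : sSup s ∈ s
      · have : s = Set.Iic (sSup s) :=
          Set.Subset.antisymm (fun a ha => le_csSup hb ha) fun a ha => hs ha hmem
        rw [this]
        exact h _
      · have : s = Set.Iio (sSup s) := by
          refine Set.Subset.antisymm (fun a ha => lt_of_le_of_ne (le_csSup hb ha) ?_) fun a ha => ?_
          · rintro rfl
            exact hmem ha
          · obtain ⟨b, hb, hab⟩ := exists_lt_of_lt_csSup hne ha
            exact hs hab.le hb
        rw [this]
        exact h.measure_Iio_le _
    · have : s = Set.univ := Set.eq_univ_of_forall fun a => by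
        obtain ⟨b, hb, hab⟩ := not_bddAbove_iff.1 hb a
        exact hs hab.le hb
      simp [this]
  · simp [Set.not_nonempty_iff_eq_empty.1 hne]

/-- The layer-cake formula reduces the claim to superlevel sets of `g`. -/
lemma StochasticallyDominates.lintegral_le {μ ν : Measure ℝ} [IsProbabilityMeasure μ]
    [IsProbabilityMeasure ν] (h : StochasticallyDominates μ ν) {V : Set ℝ}
    (hμ : ∀ᵐ a ∂μ, a ∈ V) (hν : ∀ᵐ a ∂ν, a ∈ V) {g : ℝ → ℝ≥0∞} (hg : Measurable g)
    (hfin : ∀ a ∈ V, g a ≠ ∞) (hmono : MonotoneOn g V) :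
    ∫⁻ a, g a ∂ν ≤ ∫⁻ a, g a ∂μ := by
  have key : ∀ ρ : Measure ℝ, (∀ᵐ a ∂ρ, a ∈ V) →
      ∫⁻ a, g a ∂ρ = ∫⁻ t in Set.Ioi (0 : ℝ), ρ {a | t < (g a).toReal} := by
    intro ρ hρ
    rw [← lintegral_eq_lintegral_meas_lt ρ (Filter.Eventually.of_forall fun a => by positivity)
      hg.ennreal_toReal.aemeasurable]
    refine lintegral_congr_ae ?_
    filter_upwards [hρ] with a ha
    exact (ENNReal.ofReal_toReal (hfin a ha)).symm
  rw [key ν hν, key μ hμ]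
  refine lintegral_mono fun t => ?_
  -- Since `g` is monotone only on `V`, its sublevel set need not be a lower set of `ℝ`; this lower
  -- set agrees with it on `V`, hence almost everywhere.
  have hL : IsLowerSet {a : ℝ | ∀ b ∈ V, b ≤ a → (g b).toReal ≤ t} :=
    fun a b hba ha c hc hcb => ha c hc (hcb.trans hba)
  have hSm : MeasurableSet {a | t < (g a).toReal} :=
    measurableSet_lt measurable_const hg.ennreal_toReal
  have hcompl : ∀ ρ : Measure ℝ, (∀ᵐ a ∂ρ, a ∈ V) →
      ρ {a | t < (g a).toReal}ᶜ = ρ {a : ℝ | ∀ b ∈ V, b ≤ a → (g b).toReal ≤ t} := by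
    intro ρ hρ
    refine measure_congr ?_
    filter_upwards [hρ] with a ha
    refine propext ⟨fun hle b hb hba => ?_, fun hle => not_lt.2 (hle a ha le_rfl)⟩
    exact (ENNReal.toReal_mono (hfin a ha) (hmono hb ha hba)).trans (not_lt.1 hle)
  have := h.measure_isLowerSet_le hL
  rw [← hcompl μ hμ, ← hcompl ν hν, prob_compl_eq_one_sub hSm, prob_compl_eq_one_sub hSm] at this
  have h2 := tsub_le_tsub_left this 1
  rwa [ENNReal.sub_sub_cancel ENNReal.one_ne_top prob_le_one,
    ENNReal.sub_sub_cancel ENNReal.one_ne_top prob_le_one] at h2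

end DynamicAuction

end

/-! ### Conditional laws of the value profile -/

noncomputable section

namespace DynamicAuction

namespace Environment

variable {m : ℕ}

instance (E : Environment m) (k : Fin m) : IsMarkovKernel (E.law k) := E.isMarkov k

instance (E : Environment m) (k : Fin m) (v : Fin m → ℝ) :
    IsProbabilityMeasure (E.stageLaw k v) :=
  inferInstanceAs (IsProbabilityMeasure (E.law k fun t => v t))

lemma measurable_update_prod (k : Fin m) :
    Measurable fun q : (Fin m → ℝ) × ℝ => Function.update q.1 k q.2 := by
  refine measurable_pi_iff.2 fun i => ?_
  by_cases h : i = k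
  · subst h
    simpa using measurable_snd
  · simp only [Function.update_of_ne h]
    fun_prop

instance (E : Environment m) (k : Fin m) : IsMarkovKernel (E.draw k) :=
  Kernel.IsMarkovKernel.map _ (measurable_update_prod k)

lemma lintegral_draw (E : Environment m) (k : Fin m) (v : Fin m → ℝ) {f : (Fin m → ℝ) → ℝ≥0∞}
    (hf : Measurable f) :
    ∫⁻ w, f w ∂E.draw k v = ∫⁻ y, f (Function.update v k y) ∂E.stageLaw k v := by
  have hm := measurable_update_prod k
  rw [draw, Kernel.lintegral_map _ hm _ hf, Kernel.prod_apply, Kernel.id_apply,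
    Kernel.comap_apply, Measure.dirac_prod]
  exact lintegral_map (hf.comp hm) (by fun_prop)

lemma drawFrom_of_lt (E : Environment m) {k : ℕ} (h : k < m) :
    E.drawFrom k = E.drawFrom (k + 1) ∘ₖ E.draw ⟨k, h⟩ := by
  rw [drawFrom, dif_pos h]

lemma drawFrom_of_le (E : Environment m) {k : ℕ} (h : m ≤ k) : E.drawFrom k = Kernel.id := by
  rw [drawFrom, dif_neg (not_lt.2 h)]

/-- Backward induction over the stages. -/
lemma stage_induction {P : ℕ → Prop} (base : ∀ k, m ≤ k → P k)
    (step : ∀ k : Fin m, P (k + 1) → P k) (k : ℕ) : P k := by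
  have : ∀ n k, m ≤ k + n → P k := by
    intro n
    induction n with
    | zero => exact base
    | succ n ih =>
      intro k hk
      rcases lt_or_ge k m with h | h
      · exact step ⟨k, h⟩ (ih (k + 1) (by omega))
      · exact base k h
  exact this m k (by omega)

instance isMarkovKernel_drawFrom (E : Environment m) (k : ℕ) : IsMarkovKernel (E.drawFrom k) := by
  induction k using stage_induction (m := m) with
  | base k h => rw [E.drawFrom_of_le h]; infer_instance
  | step k ih => rw [E.drawFrom_of_lt k.2]; infer_instance

instance (E : Environment m) : IsProbabilityMeasure E.prior :=
  inferInstanceAs (IsProbabilityMeasure (E.drawFrom 0 0))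

lemma measurable_lintegral_drawFrom (E : Environment m) (k : ℕ) {f : (Fin m → ℝ) → ℝ≥0∞}
    (hf : Measurable f) : Measurable fun v => ∫⁻ w, f w ∂E.drawFrom k v :=
  hf.lintegral_kernel

lemma lintegral_drawFrom (E : Environment m) (k : Fin m) (v : Fin m → ℝ)
    {f : (Fin m → ℝ) → ℝ≥0∞} (hf : Measurable f) :
    ∫⁻ w, f w ∂E.drawFrom k v =
      ∫⁻ y, ∫⁻ w, f w ∂E.drawFrom (k + 1) (Function.update v k y) ∂E.stageLaw k v := by
  rw [E.drawFrom_of_lt k.2, Kernel.lintegral_comp _ _ _ hf,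
    E.lintegral_draw _ _ (E.measurable_lintegral_drawFrom _ hf)]

lemma ae_drawFrom (E : Environment m) (k : Fin m) (v : Fin m → ℝ) {p : (Fin m → ℝ) → Prop}
    (hp : MeasurableSet {w | p w})
    (h : ∀ᵐ y ∂E.stageLaw k v, ∀ᵐ w ∂E.drawFrom (k + 1) (Function.update v k y), p w) :
    ∀ᵐ w ∂E.drawFrom k v, p w := by
  rw [ae_iff, show {a | ¬ p a} = {a | p a}ᶜ from rfl, ← lintegral_indicator_one hp.compl,
    E.lintegral_drawFrom k v (measurable_one.indicator hp.compl)]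
  rw [← lintegral_zero (μ := E.stageLaw k v)]
  refine lintegral_congr_ae ?_
  filter_upwards [h] with y hy
  rw [lintegral_indicator_one hp.compl]
  exact hy

lemma measurableSet_profiles (E : Environment m) : MeasurableSet E.profiles :=
  MeasurableSet.univ_pi E.measurableSet_V

lemma ae_drawFrom_eq (E : Environment m) (k : ℕ) :
    ∀ v : Fin m → ℝ, ∀ᵐ w ∂E.drawFrom k v, ∀ t : Fin m, (t : ℕ) < k → w t = v t := by
  induction k using stage_induction (m := m) with
  | base k h =>
    intro v
    rw [E.drawFrom_of_le h, Kernel.id_apply, ae_dirac_eq]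
    exact fun t _ => rfl
  | step k ih =>
    intro v
    refine E.ae_drawFrom k v ?_ (Filter.Eventually.of_forall fun y => ?_)
    · simp only [Set.ofPred_forall]
      exact MeasurableSet.iInter fun t => MeasurableSet.iInter fun _ =>
        measurableSet_eq_fun (measurable_pi_apply t) measurable_const
    · filter_upwards [ih (Function.update v k y)] with w hw t ht
      rw [hw t (by omega), Function.update_of_ne (Fin.ne_of_lt ht)]

lemma ae_stageLaw_mem (E : Environment m) (k : Fin m) {v : Fin m → ℝ}
    (hv : ∀ t : Fin m, t < k → v t ∈ E.V t) : ∀ᵐ y ∂E.stageLaw k v, y ∈ E.V k :=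
  E.law_compl k (fun t => v t) fun t => hv t t.2

lemma ae_drawFrom_mem_profiles (E : Environment m) (k : ℕ) :
    ∀ v : Fin m → ℝ, (∀ t : Fin m, (t : ℕ) < k → v t ∈ E.V t) →
      ∀ᵐ w ∂E.drawFrom k v, w ∈ E.profiles := by
  induction k using stage_induction (m := m) with
  | base k h =>
    intro v hv
    rw [E.drawFrom_of_le h, Kernel.id_apply]
    exact (ae_dirac_iff (p := (· ∈ E.profiles)) E.measurableSet_profiles).2
      fun t _ => hv t (t.2.trans_le h)
  | step k ih =>
    intro v hv
    refine E.ae_drawFrom k v E.measurableSet_profiles ?_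
    filter_upwards [E.ae_stageLaw_mem k hv] with y hy
    refine ih _ fun t ht => ?_
    rcases eq_or_ne t k with rfl | hne
    · simpa using hy
    · rw [Function.update_of_ne hne]
      exact hv t (by have := Fin.val_ne_of_ne hne; omega)

lemma ae_prior_mem_profiles (E : Environment m) : ∀ᵐ w ∂E.prior, w ∈ E.profiles :=
  E.ae_drawFrom_mem_profiles 0 0 fun _ h => absurd h (Nat.not_lt_zero _)

lemma update_mem_profiles (E : Environment m) {v : Fin m → ℝ} (hv : v ∈ E.profiles) {k : Fin m}
    {y : ℝ} (hy : y ∈ E.V k) : Function.update v k y ∈ E.profiles := by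
  intro t _
  rcases eq_or_ne t k with rfl | hne
  · simpa using hy
  · rw [Function.update_of_ne hne]
    exact hv t trivial

lemma drawFrom_congr (E : Environment m) (k : ℕ) :
    ∀ v v' : Fin m → ℝ, (∀ t : Fin m, (t : ℕ) < k → v t = v' t) →
      E.drawFrom k v = E.drawFrom k v' := by
  induction k using stage_induction (m := m) with
  | base k h =>
    intro v v' hv
    rw [show v = v' from funext fun t => hv t (t.2.trans_le h)]
  | step k ih =>
    intro v v' hv
    refine Measure.ext_of_lintegral _ fun f hf => ?_
    have h1 : E.stageLaw k v = E.stageLaw k v' := by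
      unfold stageLaw
      congr 1
      exact funext fun t => hv t t.2
    rw [E.lintegral_drawFrom k v hf, E.lintegral_drawFrom k v' hf, h1]
    refine lintegral_congr fun y => ?_
    rw [ih (Function.update v k y) (Function.update v' k y) fun t ht => ?_]
    rcases eq_or_ne t k with rfl | hne
    · simp
    · rw [Function.update_of_ne hne, Function.update_of_ne hne]
      exact hv t (by have := Fin.val_ne_of_ne hne; omega)

/-- Tower property. The kernel `E.drawFrom j` reads only the coordinates before `j` and almost
surely keeps them, so applying it twice is the same as once; earlier starting stages follow by
backward induction. -/
lemma lintegral_drawFrom_drawFrom (E : Environment m) {f : (Fin m → ℝ) → ℝ≥0∞}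
    (hf : Measurable f) {j : ℕ} (k : ℕ) :
    k ≤ j → j ≤ m → ∀ v : Fin m → ℝ,
      ∫⁻ w, ∫⁻ u, f u ∂E.drawFrom j w ∂E.drawFrom k v = ∫⁻ w, f w ∂E.drawFrom k v := by
  have hself : ∀ v : Fin m → ℝ,
      ∫⁻ w, ∫⁻ u, f u ∂E.drawFrom j w ∂E.drawFrom j v = ∫⁻ w, f w ∂E.drawFrom j v := by
    intro v
    rw [lintegral_congr_ae (g := fun _ => ∫⁻ u, f u ∂E.drawFrom j v)]
    · simp
    · filter_upwards [E.ae_drawFrom_eq j v] with w hw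
      rw [E.drawFrom_congr j w v hw]
  induction k using stage_induction (m := m) with
  | base k h =>
    intro hkj hjm v
    obtain rfl : k = j := le_antisymm hkj (hjm.trans h)
    exact hself v
  | step k ih =>
    intro hkj hjm v
    rcases hkj.eq_or_lt with rfl | hlt
    · exact hself v
    · rw [E.lintegral_drawFrom k v (E.measurable_lintegral_drawFrom _ hf),
        E.lintegral_drawFrom k v hf]
      exact lintegral_congr fun y => ih hlt hjm _

/-- Disintegration of the prior at stage `j`: a full profile is drawn, then its coordinates from `j`
on are redrawn. This exposes `E.stageLaw j v`, the law on which the one-shot bound acts. -/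
lemma lintegral_prior (E : Environment m) (j : Fin m) {f : (Fin m → ℝ) → ℝ≥0∞}
    (hf : Measurable f) :
    ∫⁻ v, f v ∂E.prior = ∫⁻ v, ∫⁻ y, ∫⁻ w, f w ∂E.drawFrom (j + 1) (Function.update v j y)
      ∂E.stageLaw j v ∂E.prior := by
  unfold prior
  rw [← E.lintegral_drawFrom_drawFrom hf 0 (Nat.zero_le j) j.2.le]
  exact lintegral_congr fun v => E.lintegral_drawFrom j v hf

end Environment

end DynamicAuction

end

/-! ### Truthful utilities and misreported histories -/

noncomputable section

namespace DynamicAuction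

variable {m : ℕ}

/-- The profile that agrees with `r` before stage `k` and with `w` from stage `k` on. -/
def splice (k : ℕ) (r w : Fin m → ℝ) : Fin m → ℝ := fun t => if (t : ℕ) < k then r t else w t

lemma measurable_splice (k : ℕ) (r : Fin m → ℝ) : Measurable (splice k r) := by
  refine measurable_pi_iff.2 fun t => ?_
  unfold splice
  split_ifs <;> fun_prop

lemma splice_eq_self {k : ℕ} {r w : Fin m → ℝ} (h : ∀ t : Fin m, (t : ℕ) < k → w t = r t) :
    splice k r w = w := by
  funext t
  unfold splice
  split_ifs with ht
  · exact (h t ht).symm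
  · rfl

lemma splice_succ_update (k : Fin m) (r w : Fin m → ℝ) (y : ℝ) :
    splice (k + 1) (Function.update r k y) w = splice k r (Function.update w k y) := by
  funext t
  unfold splice
  rcases lt_trichotomy t k with h | rfl | h
  · have h' : (t : ℕ) < k := h
    rw [if_pos (by omega), if_pos h', Function.update_of_ne h.ne]
  · simp
  · have h' : (k : ℕ) < t := h
    rw [if_neg (by omega), if_neg (by omega), Function.update_of_ne h.ne']

namespace Mechanism

lemma alloc_congr (M : Mechanism m) {k : Fin m} {r r' : Fin m → ℝ} (h : ∀ t ≤ k, r t = r' t) :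
    M.alloc k r = M.alloc k r' := by
  unfold alloc
  congr 1
  exact funext fun t => h t t.2

lemma pay_congr (M : Mechanism m) {k : Fin m} {r r' : Fin m → ℝ} (h : ∀ t ≤ k, r t = r' t) :
    M.pay k r = M.pay k r' := by
  unfold pay
  congr 1
  exact funext fun t => h t t.2

lemma measurable_alloc (M : Mechanism m) (k : Fin m) : Measurable (M.alloc k) :=
  (M.measurable_x k).comp (by fun_prop)

lemma measurable_pay (M : Mechanism m) (k : Fin m) : Measurable (M.pay k) :=
  (M.measurable_p k).comp (by fun_prop)

lemma measurable_stageUtility_self (M : Mechanism m) (k : Fin m) :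
    Measurable fun v => M.stageUtility k v v :=
  ((measurable_pi_apply k).mul (M.measurable_alloc k)).sub (M.measurable_pay k)

lemma stageUtility_self_congr (M : Mechanism m) {k : Fin m} {r r' : Fin m → ℝ}
    (h : ∀ t ≤ k, r t = r' t) : M.stageUtility k r r = M.stageUtility k r' r' := by
  unfold stageUtility
  rw [M.alloc_congr h, M.pay_congr h, h k le_rfl]

/-- The truthful utility from stage `k` on, with every stage utility cut off at `0`. -/
def truthful (M : Mechanism m) (k : ℕ) (u : Fin m → ℝ) : ℝ≥0∞ :=
  ∑ i with k ≤ (i : Fin m).val, ENNReal.ofReal (M.stageUtility i u u)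

lemma measurable_truthful (M : Mechanism m) (k : ℕ) : Measurable (M.truthful k) :=
  Finset.measurable_sum _ fun i _ => (M.measurable_stageUtility_self i).ennreal_ofReal

lemma truthful_of_le (M : Mechanism m) {k : ℕ} (h : m ≤ k) (u : Fin m → ℝ) :
    M.truthful k u = 0 := by
  unfold truthful
  rw [Finset.filter_false_of_mem fun i _ => not_le.2 (i.2.trans_le h), Finset.sum_empty]

lemma truthful_eq_add (M : Mechanism m) (k : Fin m) (u : Fin m → ℝ) :
    M.truthful k u = ENNReal.ofReal (M.stageUtility k u u) + M.truthful (k + 1) u := by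
  unfold truthful
  have : (Finset.univ.filter fun i : Fin m => (k : ℕ) ≤ i) =
      insert k (Finset.univ.filter fun i : Fin m => (k : ℕ) + 1 ≤ i) := by
    ext i
    simp only [Finset.mem_filter, Finset.mem_univ, true_and, Finset.mem_insert, Fin.ext_iff]
    omega
  rw [this, Finset.sum_insert (by simp only [Finset.mem_filter, not_and]; omega)]

variable {E : Environment m} {M : Mechanism m}

lemma ofReal_utilityFrom_self (hir : M.ExPostIR E) (k : Fin m) {u : Fin m → ℝ}
    (hu : u ∈ E.profiles) : ENNReal.ofReal (M.utilityFrom k u u) = M.truthful k u := by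
  unfold utilityFrom truthful
  rw [ENNReal.ofReal_sum_of_nonneg fun i _ => hir i u hu]
  refine Finset.sum_congr ?_ fun _ _ => rfl
  ext i
  simp only [Finset.mem_Ici, Finset.mem_filter, Finset.mem_univ, true_and, Fin.le_def]

lemma utilityFrom_self_nonneg (hir : M.ExPostIR E) (k : Fin m) {u : Fin m → ℝ}
    (hu : u ∈ E.profiles) : 0 ≤ M.utilityFrom k u u :=
  Finset.sum_nonneg fun i _ => hir i u hu

/-- Reports after stage `k` are truthful, so the deviator differs from a buyer whose value really is
`a` only in how she values the item of stage `k`. -/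
lemma utilityFrom_update (M : Mechanism m) (k : Fin m) (w : Fin m → ℝ) (a : ℝ) :
    M.utilityFrom k w (Function.update w k a) =
      (w k - a) * M.alloc k (Function.update w k a) +
        M.utilityFrom k (Function.update w k a) (Function.update w k a) := by
  unfold utilityFrom
  rw [← Finset.add_sum_erase _ _ (Finset.mem_Ici.2 (le_refl k)),
    ← Finset.add_sum_erase (a := k) _ (fun j => M.stageUtility j (Function.update w k a) _)
      (Finset.mem_Ici.2 (le_refl k)), ← add_assoc]
  congr 1
  · simp only [stageUtility, Function.update_self]
    ring
  · refine Finset.sum_congr rfl fun i hi => ?_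
    simp only [stageUtility, Function.update_of_ne (Finset.ne_of_mem_erase hi)]

/-- The expected utility from stage `k` on of a buyer with history and value `s`, who is truthful. -/
def continuation (M : Mechanism m) (E : Environment m) (k : Fin m) (s : Fin m → ℝ) : ℝ≥0∞ :=
  ∫⁻ w, M.truthful k w ∂E.drawFrom (k + 1) s

lemma measurable_continuation (M : Mechanism m) (E : Environment m) (k : Fin m) :
    Measurable (M.continuation E k) :=
  E.measurable_lintegral_drawFrom _ (M.measurable_truthful k)

lemma continuation_eq_ofReal (hir : M.ExPostIR E) (hic : M.PeriodicIC E) (k : Fin m)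
    {s : Fin m → ℝ} (hs : s ∈ E.profiles) :
    M.continuation E k s =
      ENNReal.ofReal (∫ w, M.utilityFrom k w w ∂E.drawFrom (k + 1) s) := by
  have hae := E.ae_drawFrom_mem_profiles (k + 1) s fun t _ => hs t trivial
  rw [ofReal_integral_eq_lintegral_ofReal (hic k s hs (s k) (hs k trivial)).1
    (hae.mono fun w hw => utilityFrom_self_nonneg hir k hw)]
  exact lintegral_congr_ae (hae.mono fun w hw => (ofReal_utilityFrom_self hir k hw).symm)

lemma continuation_ne_top (hir : M.ExPostIR E) (hic : M.PeriodicIC E) (k : Fin m)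
    {s : Fin m → ℝ} (hs : s ∈ E.profiles) : M.continuation E k s ≠ ∞ := by
  rw [continuation_eq_ofReal hir hic k hs]
  exact ENNReal.ofReal_ne_top

/-- Buyers whose true history dominates the reported one expect at least as much utility from
stage `k` on as if the report were true. -/
def DominanceFrom (M : Mechanism m) (E : Environment m) (k : ℕ) : Prop :=
  ∀ r ∈ E.profiles, ∀ v ∈ E.profiles, (∀ t : Fin m, (t : ℕ) < k → r t ≤ v t) →
    ∫⁻ w, M.truthful k w ∂E.drawFrom k r ≤ ∫⁻ w, M.truthful k (splice k r w) ∂E.drawFrom k v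

lemma lintegral_truthful_splice (M : Mechanism m) (E : Environment m) (k : Fin m)
    (r v : Fin m → ℝ) :
    ∫⁻ w, M.truthful k (splice (k + 1) r w) ∂E.drawFrom (k + 1) v =
      ENNReal.ofReal (M.stageUtility k r r) +
        ∫⁻ w, M.truthful (k + 1) (splice (k + 1) r w) ∂E.drawFrom (k + 1) v := by
  have h : ∀ w, M.truthful k (splice (k + 1) r w) =
      ENNReal.ofReal (M.stageUtility k r r) + M.truthful (k + 1) (splice (k + 1) r w) := by
    intro w
    rw [truthful_eq_add]
    congr 2
    refine M.stageUtility_self_congr fun t ht => ?_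
    exact if_pos (Nat.lt_succ_of_le ht)
  simp_rw [h]
  rw [lintegral_add_left measurable_const]
  simp

lemma lintegral_splice_self (E : Environment m) (k : ℕ) (r : Fin m → ℝ)
    (f : (Fin m → ℝ) → ℝ≥0∞) :
    ∫⁻ w, f (splice k r w) ∂E.drawFrom k r = ∫⁻ w, f w ∂E.drawFrom k r :=
  lintegral_congr_ae ((E.ae_drawFrom_eq k r).mono fun w hw => by
    simp only [splice_eq_self hw])

/-- The utility of stage `k` is fixed by `r` and is the same on both sides; the true history matters
only for the later stages, where the hypothesis applies. -/
lemma DominanceFrom.continuation_le {k : Fin m} (h : M.DominanceFrom E (k + 1)) {r v : Fin m → ℝ}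
    (hr : r ∈ E.profiles) (hv : v ∈ E.profiles) (hrv : ∀ t ≤ k, r t ≤ v t) :
    M.continuation E k r ≤
      ∫⁻ w, M.truthful k (splice (k + 1) r w) ∂E.drawFrom (k + 1) v := by
  unfold continuation
  rw [← lintegral_splice_self, lintegral_truthful_splice, lintegral_truthful_splice,
    lintegral_splice_self]
  refine add_le_add le_rfl ?_
  exact h r hr v hv fun t ht => hrv t (Nat.le_of_lt_succ ht)

/-- Incentive compatibility for downward deviations, in envelope form. -/
lemma DominanceFrom.continuation_add_le {k : Fin m} (h : M.DominanceFrom E (k + 1))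
    (hf : M.Feasible E) (hir : M.ExPostIR E) (hic : M.PeriodicIC E) {r : Fin m → ℝ}
    (hr : r ∈ E.profiles) {a b : ℝ} (ha : a ∈ E.V k) (hb : b ∈ E.V k) (hab : a ≤ b) :
    M.continuation E k (Function.update r k a) +
        ENNReal.ofReal ((b - a) * M.alloc k (Function.update r k a)) ≤
      M.continuation E k (Function.update r k b) := by
  have hra := E.update_mem_profiles hr ha
  have hrb := E.update_mem_profiles hr hb
  have hc : 0 ≤ (b - a) * M.alloc k (Function.update r k a) :=
    mul_nonneg (sub_nonneg.2 hab) (hf k _ hra).1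
  have hle : ∀ t ≤ k, Function.update r k a t ≤ Function.update r k b t := fun t _ => by
    rcases eq_or_ne t k with rfl | hne
    · simpa using hab
    · simp [Function.update_of_ne hne]
  have hmem := E.ae_drawFrom_mem_profiles (k + 1) (Function.update r k b) fun t _ => hrb t trivial
  have heq := E.ae_drawFrom_eq (k + 1) (Function.update r k b)
  -- A buyer of value `b` reporting `a` receives what type `a` would receive on the same later
  -- values, plus `b - a` times the allocation.
  have hdev : ∀ᵐ w ∂E.drawFrom (k + 1) (Function.update r k b),
      0 ≤ M.utilityFrom k w (Function.update w k a) ∧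
      ENNReal.ofReal (M.utilityFrom k w (Function.update w k a)) =
        M.truthful k (splice (k + 1) (Function.update r k a) w) +
          ENNReal.ofReal ((b - a) * M.alloc k (Function.update r k a)) := by
    filter_upwards [hmem, heq] with w hw hwr
    have hwa := E.update_mem_profiles hw ha
    have hlt : ∀ t : Fin m, (t : ℕ) < k → w t = r t := fun t ht => by
      rw [hwr t (by omega), Function.update_of_ne (Fin.ne_of_lt ht)]
    have hwk : w k = b := by rw [hwr k (by omega), Function.update_self]
    have hspl : splice (k + 1) (Function.update r k a) w = Function.update w k a := by
      rw [splice_succ_update]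
      exact splice_eq_self fun t ht => by
        rw [Function.update_of_ne (Fin.ne_of_lt ht), hlt t ht]
    have hal : M.alloc k (Function.update w k a) = M.alloc k (Function.update r k a) := by
      refine M.alloc_congr fun t ht => ?_
      rcases ht.eq_or_lt with rfl | ht
      · simp
      · rw [Function.update_of_ne ht.ne, Function.update_of_ne ht.ne, hlt t ht]
    have h0 := utilityFrom_self_nonneg hir k hwa
    rw [utilityFrom_update, hspl, hal, hwk, ENNReal.ofReal_add hc h0,
      ofReal_utilityFrom_self hir k hwa, add_comm (ENNReal.ofReal _)]
    exact ⟨add_nonneg hc h0, rfl⟩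
  obtain ⟨-, hint, hineq⟩ := hic k _ hrb a ha
  calc _ ≤ ∫⁻ w, M.truthful k (splice (k + 1) (Function.update r k a) w)
          ∂E.drawFrom (k + 1) (Function.update r k b) +
        ENNReal.ofReal ((b - a) * M.alloc k (Function.update r k a)) := by
        gcongr
        exact h.continuation_le hra hrb hle
    _ = ∫⁻ w, (M.truthful k (splice (k + 1) (Function.update r k a) w) +
          ENNReal.ofReal ((b - a) * M.alloc k (Function.update r k a)))
          ∂E.drawFrom (k + 1) (Function.update r k b) := by
        rw [lintegral_add_right _ measurable_const]
        simp
    _ = ∫⁻ w, ENNReal.ofReal (M.utilityFrom k w (Function.update w k a))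
          ∂E.drawFrom (k + 1) (Function.update r k b) :=
        lintegral_congr_ae (hdev.mono fun w hw => hw.2.symm)
    _ = ENNReal.ofReal (∫ w, M.utilityFrom k w (Function.update w k a)
          ∂E.drawFrom (k + 1) (Function.update r k b)) :=
        (ofReal_integral_eq_lintegral_ofReal hint (hdev.mono fun w hw => hw.1)).symm
    _ ≤ _ := by
        rw [continuation_eq_ofReal hir hic k hrb]
        exact ENNReal.ofReal_le_ofReal hineq

lemma lintegral_drawFrom_splice (M : Mechanism m) (E : Environment m) (k : Fin m)
    (r v : Fin m → ℝ) :
    ∫⁻ w, M.truthful k (splice k r w) ∂E.drawFrom k v =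
      ∫⁻ y, ∫⁻ w, M.truthful k (splice (k + 1) (Function.update r k y) w)
        ∂E.drawFrom (k + 1) (Function.update v k y) ∂E.stageLaw k v := by
  refine (E.lintegral_drawFrom k v
    ((M.measurable_truthful k).comp (measurable_splice k r))).trans ?_
  refine lintegral_congr fun y => lintegral_congr_ae ?_
  filter_upwards [E.ae_drawFrom_eq (k + 1) (Function.update v k y)] with w hw
  have hwk : w k = y := by rw [hw k (by omega), Function.update_self]
  rw [splice_succ_update, ← hwk, Function.update_eq_self, Function.comp_apply]

/-- Two exchanges. The law of the stage-`k` value is replaced by the dominating one, which helps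
because the continuation utility increases in that value by downward incentive compatibility. Then
the true history replaces the reported one in the later stages, by the induction hypothesis. -/
theorem dominanceFrom (hE : E.StochasticallyMonotone) (hf : M.Feasible E) (hir : M.ExPostIR E)
    (hic : M.PeriodicIC E) (k : ℕ) : M.DominanceFrom E k := by
  induction k using Environment.stage_induction (m := m) with
  | base k h =>
    intro r _ v _ _
    simp [M.truthful_of_le h]
  | step k ih =>
    intro r hr v hv hrv
    have hmeas : Measurable fun y => M.continuation E k (Function.update r k y) :=
      (M.measurable_continuation E k).comp (measurable_update r)
    have hrV := E.ae_stageLaw_mem k fun t _ => hr t trivial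
    have hvV := E.ae_stageLaw_mem k fun t _ => hv t trivial
    have hdom : StochasticallyDominates (E.stageLaw k v) (E.stageLaw k r) :=
      hE k _ _ (fun t => hv t trivial) (fun t => hr t trivial) fun t => hrv t t.2
    calc ∫⁻ w, M.truthful k w ∂E.drawFrom k r
        = ∫⁻ y, M.continuation E k (Function.update r k y) ∂E.stageLaw k r :=
          E.lintegral_drawFrom k r (M.measurable_truthful k)
      _ ≤ ∫⁻ y, M.continuation E k (Function.update r k y) ∂E.stageLaw k v :=
          hdom.lintegral_le hvV hrV hmeas
            (fun a ha => continuation_ne_top hir hic k (E.update_mem_profiles hr ha))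
            fun a ha b hb hab => le_self_add.trans (ih.continuation_add_le hf hir hic hr ha hb hab)
      _ ≤ ∫⁻ w, M.truthful k (splice k r w) ∂E.drawFrom k v := by
          rw [lintegral_drawFrom_splice]
          refine lintegral_mono_ae ?_
          filter_upwards [hvV] with y hy
          refine ih.continuation_le (E.update_mem_profiles hr hy) (E.update_mem_profiles hv hy) ?_
          intro t ht
          rcases ht.eq_or_lt with rfl | ht
          · simp
          · rw [Function.update_of_ne ht.ne, Function.update_of_ne ht.ne]
            exact hrv t ht

/-! ### Welfare of a stage and the revenue bound -/

/-- The expected welfare of stage `j` is at most Myerson's revenue and the buyer's utility from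
stage `j` on. -/
lemma lintegral_stage_welfare_le (hE : E.StochasticallyMonotone) (hf : M.Feasible E)
    (hir : M.ExPostIR E) (hic : M.PeriodicIC E) (j : Fin m) :
    ∫⁻ v, ENNReal.ofReal (v j * M.alloc j v) ∂E.prior ≤
      expectedMyerson E j + ∫⁻ v, M.truthful j v ∂E.prior := by
  have hwelf : Measurable fun v : Fin m → ℝ => ENNReal.ofReal (v j * M.alloc j v) :=
    ((measurable_pi_apply j).mul (M.measurable_alloc j)).ennreal_ofReal
  have hstage : ∀ v ∈ E.profiles,
      ∫⁻ y, ∫⁻ w, ENNReal.ofReal (w j * M.alloc j w) ∂E.drawFrom (j + 1) (Function.update v j y)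
        ∂E.stageLaw j v ≤ myerson (E.V j) (E.stageLaw j v) +
          ∫⁻ y, M.continuation E j (Function.update v j y) ∂E.stageLaw j v := by
    intro v hv
    have hV := E.ae_stageLaw_mem j fun t _ => hv t trivial
    have hfin : ∀ a ∈ E.V j, M.continuation E j (Function.update v j a) ≠ ∞ := fun a ha =>
      continuation_ne_top hir hic j (E.update_mem_profiles hv ha)
    have hstatic := lintegral_welfare_le_myerson_add (μ := E.stageLaw j v)
      (x := fun a => M.alloc j (Function.update v j a))
      (U := fun a => (M.continuation E j (Function.update v j a)).toReal)
      (E.nonneg j) (E.bddAbove j) hV (fun a ha => hf j _ (E.update_mem_profiles hv ha))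
      (fun a _ => ENNReal.toReal_nonneg) fun a ha b hb hab => by
        have hc : 0 ≤ (b - a) * M.alloc j (Function.update v j a) :=
          mul_nonneg (sub_nonneg.2 hab) (hf j _ (E.update_mem_profiles hv ha)).1
        have := ENNReal.toReal_mono (hfin b hb)
          ((dominanceFrom hE hf hir hic (j + 1)).continuation_add_le hf hir hic hv ha hb hab)
        rwa [ENNReal.toReal_add (hfin a ha) ENNReal.ofReal_ne_top, ENNReal.toReal_ofReal hc] at this
    refine (le_of_eq ?_).trans (hstatic.trans (add_le_add le_rfl (le_of_eq ?_)))
    -- The welfare of stage `j` is almost surely constant once the coordinates up to `j` are fixed,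
    -- so the inner integral collapses.
    · refine lintegral_congr fun y => ?_
      rw [lintegral_congr_ae
        (g := fun _ => ENNReal.ofReal (y * M.alloc j (Function.update v j y)))]
      · simp
      · filter_upwards [E.ae_drawFrom_eq (j + 1) (Function.update v j y)] with w hw
        rw [M.alloc_congr fun t ht => hw t (Nat.lt_succ_of_le ht), hw j (by omega),
          Function.update_self]
    · exact lintegral_congr_ae (hV.mono fun y hy => ENNReal.ofReal_toReal (hfin y hy))
  have hcont : ∀ v, ∫⁻ y, M.continuation E j (Function.update v j y) ∂E.stageLaw j v =
      ∫⁻ w, M.truthful j w ∂E.drawFrom j v := fun v =>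
    (E.lintegral_drawFrom j v (M.measurable_truthful j)).symm
  rw [E.lintegral_prior j hwelf, E.lintegral_prior j (M.measurable_truthful j), expectedMyerson]
  refine (lintegral_mono_ae (E.ae_prior_mem_profiles.mono hstage)).trans (le_of_eq ?_)
  refine lintegral_add_right _ ?_
  simp_rw [hcont]
  exact E.measurable_lintegral_drawFrom j (M.measurable_truthful j)

/-- Individual rationality lets the utilities before stage `j` be discarded; payments plus all
utilities are exactly the welfare. -/
lemma totalPay_add_utilityFrom_le (hf : M.Feasible E) (hir : M.ExPostIR E) (j : Fin m)
    {v : Fin m → ℝ} (hv : v ∈ E.profiles) :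
    M.totalPay v + M.utilityFrom j v v ≤
      ∑ k ∈ Finset.univ.erase j, v k + v j * M.alloc j v := by
  have h1 : M.utilityFrom j v v ≤ ∑ k, M.stageUtility k v v :=
    Finset.sum_le_sum_of_subset_of_nonneg (Finset.subset_univ _) fun k _ _ => hir k v hv
  have h2 : M.totalPay v + ∑ k, M.stageUtility k v v = ∑ k, v k * M.alloc k v := by
    unfold totalPay
    rw [← Finset.sum_add_distrib]
    exact Finset.sum_congr rfl fun k _ => by unfold stageUtility; ring
  have h3 : ∑ k ∈ Finset.univ.erase j, v k * M.alloc k v ≤ ∑ k ∈ Finset.univ.erase j, v k :=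
    Finset.sum_le_sum fun k _ =>
      mul_le_of_le_one_right (E.nonneg k _ (hv k trivial)) (hf k v hv).2
  rw [← Finset.sum_erase_add _ (fun k => v k * M.alloc k v) (Finset.mem_univ j)] at h2
  linarith

end Mechanism

lemma Environment.integrable_value (E : Environment m) (k : Fin m) :
    Integrable (fun v => v k) E.prior := by
  obtain ⟨B, hB⟩ := E.bddAbove k
  refine Integrable.of_bound (measurable_pi_apply k).aestronglyMeasurable B ?_
  filter_upwards [E.ae_prior_mem_profiles] with v hv
  rw [Real.norm_of_nonneg (E.nonneg k _ (hv k trivial))]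
  exact hB (hv k trivial)

theorem Mechanism.Admissible.ofReal_revenue_le {E : Environment m} {M : Mechanism m}
    (hM : M.Admissible E) (hE : E.StochasticallyMonotone) (j : Fin m) :
    ENNReal.ofReal (M.revenue E) ≤
      expectedMyerson E j + ∑ k ∈ Finset.univ.erase j, expectedValue E k := by
  obtain ⟨hf, hir, hic, hpay⟩ := hM
  have hprof := E.ae_prior_mem_profiles
  have hvals : Integrable (fun v : Fin m → ℝ => ∑ k ∈ Finset.univ.erase j, v k) E.prior :=
    integrable_finsetSum _ fun k _ => E.integrable_value k
  have hwelf : Integrable (fun v => v j * M.alloc j v) E.prior := by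
    refine (E.integrable_value j).mono
      ((measurable_pi_apply j).mul (M.measurable_alloc j)).aestronglyMeasurable ?_
    filter_upwards [hprof] with v hv
    have hx := hf j v hv
    rw [norm_mul, Real.norm_of_nonneg hx.1]
    exact mul_le_of_le_one_right (norm_nonneg _) hx.2
  -- Periodic incentive compatibility gives integrability only conditionally on a history. Under the
  -- prior it comes from the bound of the nonnegative utility by values plus welfare minus payments.
  have hutil : Integrable (fun v => M.utilityFrom j v v) E.prior := by
    refine ((hvals.add hwelf).sub hpay).mono
      (Finset.measurable_sum _ fun i _ => M.measurable_stageUtility_self i).aestronglyMeasurable ?_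
    filter_upwards [hprof] with v hv
    have h1 := M.totalPay_add_utilityFrom_le hf hir j hv
    rw [Real.norm_of_nonneg (utilityFrom_self_nonneg hir j hv)]
    refine le_trans ?_ (le_abs_self _)
    simp only [Pi.sub_apply, Pi.add_apply]
    linarith
  have hreal : M.revenue E + ∫ v, M.utilityFrom j v v ∂E.prior ≤
      (∑ k ∈ Finset.univ.erase j, ∫ v, v k ∂E.prior) + ∫ v, v j * M.alloc j v ∂E.prior := by
    unfold revenue
    rw [← integral_add hpay hutil, ← integral_finsetSum _ fun k _ => E.integrable_value k,
      ← integral_add hvals hwelf]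
    exact integral_mono_ae (hpay.add hutil) (hvals.add hwelf)
      (hprof.mono fun v hv => M.totalPay_add_utilityFrom_le hf hir j hv)
  have hwelf0 : 0 ≤ᵐ[E.prior] fun v => v j * M.alloc j v := hprof.mono fun v hv =>
    mul_nonneg (E.nonneg j _ (hv j trivial)) (hf j v hv).1
  have hutil0 : 0 ≤ᵐ[E.prior] fun v => M.utilityFrom j v v := hprof.mono fun v hv =>
    utilityFrom_self_nonneg hir j hv
  have hval0 : ∀ k, 0 ≤ ∫ v, v k ∂E.prior := fun k =>
    integral_nonneg_of_ae (hprof.mono fun v hv => E.nonneg k _ (hv k trivial))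
  have hstage := lintegral_stage_welfare_le hE hf hir hic j
  rw [← ofReal_integral_eq_lintegral_ofReal hwelf hwelf0,
    ← lintegral_congr_ae (hprof.mono fun v hv => ofReal_utilityFrom_self hir j hv),
    ← ofReal_integral_eq_lintegral_ofReal hutil hutil0] at hstage
  rcases le_total (M.revenue E) 0 with hneg | hpos
  · simp [ENNReal.ofReal_of_nonpos hneg]
  -- The expected utility is finite, so it may be added to both sides and cancelled in `[0, ∞]`.
  refine (ENNReal.add_le_add_iff_right
    (ENNReal.ofReal_ne_top (r := ∫ v, M.utilityFrom j v v ∂E.prior))).1 ?_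
  unfold expectedValue
  rw [← ENNReal.ofReal_add hpos (integral_nonneg_of_ae hutil0),
    ← ENNReal.ofReal_sum_of_nonneg fun k _ => hval0 k]
  refine (ENNReal.ofReal_le_ofReal hreal).trans ?_
  rw [ENNReal.ofReal_add (Finset.sum_nonneg fun k _ => hval0 k) (integral_nonneg_of_ae hwelf0)]
  refine (add_le_add le_rfl hstage).trans (le_of_eq ?_)
  ring

end DynamicAuction

end

theorem mainTheorem6 {m : ℕ} (E : DynamicAuction.Environment m)
    (hE : E.StochasticallyMonotone) :
    DynamicAuction.opt E ≤
      ⨅ j : Fin m, (DynamicAuction.expectedMyerson E j +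
        ∑ k ∈ Finset.univ.erase j, DynamicAuction.expectedValue E k) :=
  iSup₂_le fun _ hM => le_iInf fun j => hM.ofReal_revenue_le hE j
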